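/- Let $G$ be a finite simple graph with connected components $G_1,\dots,G_k$, where $G_i$ has $n_i$ vertices, and let $S(G_i)$ denote the set of all real symmetric matrices, with rows and columns indexed by the vertices of $G_i$, whose off-diagonal $(u,v)$ entry is nonzero if and only if $\{u,v\}$ is an edge of $G_i$ (the diagonal being unrestricted). Let $V=(v_{ji})$ be an $r\times k$ matrix with all entries in $\{0,1\}$ that fits $G$, i.e. $\sum_{j=1}^r v_{ji}=n_i$ for $i=1,\dots,k$. Then $V$ is a multiplicity matrix for $G$ and it is generically realisable for $G$. Explicitly, for every $i\in\{1,\dots,k\}$ and all real numbers $\lambda_1<\dots<\lambda_r$, let $\sigma_i$ be the multiset containing each $\lambda_j$ with multiplicity $v_{ji}$. Then: 1. there is a matrix $A\in S(G_i)$ whose spectrum (counted with multiplicity) is $\sigma_i$; 2. for every diagonal matrix $D\in\mathbb{R}^{n_i\times n_i}$ whose diagonal entries are the elements of $\sigma_i$ in some order, and every finite set $\mathcal Y\subseteq\mathbb{R}^{n_i}\setminus\{\mathbf 0\}$, there is an orthogonal matrix $U\in\mathbb{R}^{n_i\times n_i}$ such that $UDU^\top\in S(G_i)$ and, for every $\mathbf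 y\in\mathcal Y$, all entries of $U\mathbf y$ are nonzero. (That $V$ is a multiplicity matrix for $G$ means that for each $i$ the spectrum $\sigma_i$ is attained in $S(G_i)$ for at least one choice of $\lambda_1<\dots<\lambda_r$.) -/

import Mathlib

namespace IEPG

/-- `S(G)`: the real symmetric matrices whose off-diagonal support is exactly the edge set of `G`;
the diagonal is unrestricted. -/
def S {α : Type*} (G : SimpleGraph α) : Set (Matrix α α ℝ) :=
  {A | A.IsSymm ∧ ∀ i j, i ≠ j → (A i j ≠ 0 ↔ G.Adj i j)}

/-- The spectrum of a square real matrix as a multiset: the real eigenvalues, counted with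
algebraic multiplicity. -/
noncomputable def spec {α : Type*} [Fintype α] [DecidableEq α] (A : Matrix α α ℝ) : Multiset ℝ :=
  A.charpoly.roots

/-- A vector without zero entries. -/
def NowhereZero {α : Type*} (v : α → ℝ) : Prop := ∀ i, v i ≠ 0

/-- The multiset `{l₁^(m₁), …, l_r^(m_r)}`. -/
def withMult {r : ℕ} (m : Fin r → ℕ) (l : Fin r → ℝ) : Multiset ℝ :=
  ∑ j, Multiset.replicate (m j) (l j)

section Connected

variable {α : Type*} [Fintype α] [DecidableEq α]

/-- The multiset `σ` is realisable for `G`. -/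
def Realisable (G : SimpleGraph α) (σ : Multiset ℝ) : Prop :=
  ∃ A ∈ S G, spec A = σ

/-- The multiset `σ` is generically realisable for `G`: it is realisable and, for every diagonal
matrix `D` with diagonal `σ` (in any order) and every finite set `Y` of nonzero vectors, some
orthogonal `U` has `U D Uᵀ ∈ S(G)` and `U y` nowhere-zero for all `y ∈ Y`. -/
def GenericallyRealisable (G : SimpleGraph α) (σ : Multiset ℝ) : Prop :=
  Realisable G σ ∧
    ∀ d : α → ℝ, Finset.univ.val.map d = σ →
      ∀ Y : Set (α → ℝ), Y.Finite → (∀ y ∈ Y, y ≠ 0) →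
        ∃ U ∈ Matrix.orthogonalGroup α ℝ,
          U * Matrix.diagonal d * U.transpose ∈ S G ∧ ∀ y ∈ Y, NowhereZero (U.mulVec y)

/-- `m` is an ordered multiplicity vector of `G`. -/
def IsOrderedMultiplicityVector (G : SimpleGraph α) {r : ℕ} (m : Fin r → ℕ) : Prop :=
  ∃ l : Fin r → ℝ, StrictMono l ∧ Realisable G (withMult m l)

/-- `m` is spectrally arbitrary for `G`. -/
def SpectrallyArbitrary (G : SimpleGraph α) {r : ℕ} (m : Fin r → ℕ) : Prop :=
  ∀ l : Fin r → ℝ, StrictMono l → Realisable G (withMult m l)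

/-- The vector `m` is generically realisable for `G`. -/
def GenericallyRealisableVector (G : SimpleGraph α) {r : ℕ} (m : Fin r → ℕ) : Prop :=
  SpectrallyArbitrary G m ∧
    ∀ l : Fin r → ℝ, StrictMono l → GenericallyRealisable G (withMult m l)

end Connected

section Matrices

variable {α : Type*} [Fintype α] (G : SimpleGraph α) {r k : ℕ}

/-- `V` fits `G`, whose components are labelled by `e`: the column sums of `V` are the orders of
the corresponding components. -/
def Fits (e : Fin k ≃ G.ConnectedComponent) (V : Matrix (Fin r) (Fin k) ℕ) : Prop :=
  ∀ i, ∑ j, V j i = Nat.card (e i)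

/-- All entries of `V` are `0` or `1`. -/
def IsZeroOne (V : Matrix (Fin r) (Fin k) ℕ) : Prop := ∀ j i, V j i = 0 ∨ V j i = 1

open scoped Classical in
/-- `V` is a multiplicity matrix for `G`, with components labelled by `e`: its `i`th column is an
ordered multiplicity vector of the `i`th component. -/
def IsMultiplicityMatrix (e : Fin k ≃ G.ConnectedComponent) (V : Matrix (Fin r) (Fin k) ℕ) :
    Prop :=
  ∀ i, IsOrderedMultiplicityVector (e i).toSimpleGraph (fun j => V j i)

open scoped Classical in
/-- `V` is a generically realisable multiplicity matrix for `G`, with components labelled by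
`e`. -/
def GenericallyRealisableMatrix (e : Fin k ≃ G.ConnectedComponent)
    (V : Matrix (Fin r) (Fin k) ℕ) : Prop :=
  IsMultiplicityMatrix G e V ∧
    ∀ i, GenericallyRealisableVector (e i).toSimpleGraph (fun j => V j i)

end Matrices

end IEPG

/-! A 0/1 column summing to n_i prescribes n_i distinct eigenvalues, so it suffices to treat simple
spectra on a connected graph. Induct by deleting a non-cut vertex. Let A₁ realise the smaller graph
and let δ be the remaining eigenvalue. The matrix A = A₁ ⊕ (δ) has the right spectrum but no edges
at the new vertex, so it is deformed isospectrally.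

If K ↦ [K, A] is injective modulo diagonal matrices on skew K (`Nondegenerate`), the inverse
function theorem gives orthogonal conjugates whose off-diagonal part is exactly that of A + t[K, A]
(`exists_orthogonal_curve`). For K with border k, the border of [K, A] is (δ - A₁)k. Taking k = (δ -
A₁)⁻¹b, with b supported on the neighbours of the new vertex, creates exactly the missing edges for
t ≠ 0.

Every entry required to be nonzero is either nonzero at t = 0 or has nonzero derivative there, for
generic b. This uses resolvents of A₁ without zero entries, so that condition joins the induction
hypothesis (`RobustlyRealisable`, `RobustlyRealisable.add_vertex`). -/

namespace IEPG

open Filter Topology Matrix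

/-! ### Isospectral deformation by the inverse function theorem -/

section Curve

variable {α : Type*}

/-- `A` is nondegenerate if the only skew-symmetric matrix whose commutator with `A` is diagonal
is zero. -/
def Nondegenerate [Fintype α] (A : Matrix α α ℝ) : Prop :=
  ∀ K : Matrix α α ℝ, Kᵀ = -K → (∀ i j, i ≠ j → (K * A - A * K) i j = 0) → K = 0

/-- The linear map which keeps the entries satisfying `p` and replaces the others by zero. -/
def mask (p : α → α → Prop) [∀ i j, Decidable (p i j)] : Matrix α α ℝ →ₗ[ℝ] Matrix α α ℝ where
  toFun A := Matrix.of fun i j => if p i j then A i j else 0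
  map_add' A B := by ext i j; by_cases h : p i j <;> simp [h]
  map_smul' c A := by ext i j; by_cases h : p i j <;> simp [h]

lemma mask_apply (p : α → α → Prop) [∀ i j, Decidable (p i j)] (A : Matrix α α ℝ) (i j : α) :
    mask p A i j = if p i j then A i j else 0 := rfl

lemma isSymm_entries_eq [LinearOrder α] {M N : Matrix α α ℝ} (hM : Mᵀ = M) (hN : Nᵀ = N)
    {i j : α} (hij : i ≠ j) (h : ∀ i j, ¬ i ≤ j → M i j = N i j) : M i j = N i j := by
  rcases le_or_gt i j with hle | hlt
  · have := h j i (not_le.mpr (lt_of_le_of_ne hle hij))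
    rwa [← hM, ← hN]
  · exact h i j (not_le.mpr hlt)

lemma eq_of_isSymm_of_upper [LinearOrder α] {M N : Matrix α α ℝ} (hM : Mᵀ = M) (hN : Nᵀ = N)
    (h : ∀ i j, i ≤ j → M i j = N i j) : M = N := by
  ext i j
  rcases le_total i j with hle | hle
  · exact h i j hle
  · have := h j i hle
    rwa [← hM, ← hN]

variable [Fintype α] [DecidableEq α]

/-- Records the Gram matrix of the rows of `U` on and above the diagonal, and `U * D * Uᵀ` below. -/
def gramConj [LinearOrder α] (D U : Matrix α α ℝ) : Matrix α α ℝ :=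
  mask (· ≤ ·) (U * Uᵀ) + mask (fun i j => ¬ i ≤ j) (U * D * Uᵀ)

/-- The derivative of `gramConj D` at `U`. -/
def gramConjDeriv [LinearOrder α] (D U : Matrix α α ℝ) : Matrix α α ℝ →ₗ[ℝ] Matrix α α ℝ where
  toFun H := mask (· ≤ ·) (H * Uᵀ + U * Hᵀ) +
    mask (fun i j => ¬ i ≤ j) (H * D * Uᵀ + U * D * Hᵀ)
  map_add' A B := by
    simp only [add_mul, mul_add, transpose_add, map_add]; abel
  map_smul' c A := by
    simp [transpose_smul, ← smul_add]

lemma gramConjDeriv_apply [LinearOrder α] (D U H : Matrix α α ℝ) :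
    gramConjDeriv D U H = mask (· ≤ ·) (H * Uᵀ + U * Hᵀ) +
    mask (fun i j => ¬ i ≤ j) (H * D * Uᵀ + U * D * Hᵀ) := rfl

/-- Write H = KU. Vanishing of the Gram part makes K skew, and vanishing of the other part makes [K,
U D Uᵀ] diagonal. -/
lemma gramConjDeriv_injective [LinearOrder α] {D U : Matrix α α ℝ} (hD : Dᵀ = D)
    (hU : U * Uᵀ = 1) (hA : Nondegenerate (U * D * Uᵀ)) :
    Function.Injective (gramConjDeriv D U) := by
  have hU' : Uᵀ * U = 1 := mul_eq_one_comm.mp hU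
  rw [← LinearMap.ker_eq_bot, LinearMap.ker_eq_bot']
  intro H hH
  have hent : ∀ i j, gramConjDeriv D U H i j = 0 := fun i j => by rw [hH]; rfl
  simp only [gramConjDeriv_apply, Matrix.add_apply (mask _ _), mask_apply] at hent
  have hskew : H * Uᵀ + U * Hᵀ = 0 := by
    refine eq_of_isSymm_of_upper (by simp [add_comm]) (by simp) fun i j hij => ?_
    have := hent i j
    simpa [hij] using this
  have hHe : H = (H * Uᵀ) * U := by rw [Matrix.mul_assoc, hU', Matrix.mul_one]
  have hHt : U * Hᵀ = -(H * Uᵀ) := (neg_eq_of_add_eq_zero_right hskew).symm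
  have hK : H * Uᵀ = 0 := by
    apply hA
    · rw [transpose_mul, transpose_transpose, hHt]
    · intro i j hij
      have hcomm : (H * Uᵀ) * (U * D * Uᵀ) - (U * D * Uᵀ) * (H * Uᵀ)
          = H * D * Uᵀ + U * D * Hᵀ := by
        rw [sub_eq_add_neg, ← mul_neg, ← hHt]
        congr 1
        · calc _ = H * (Uᵀ * U) * D * Uᵀ := by simp only [Matrix.mul_assoc]
            _ = _ := by rw [hU', Matrix.mul_one]
        · calc _ = U * D * (Uᵀ * U) * Hᵀ := by simp only [Matrix.mul_assoc]
            _ = _ := by rw [hU', Matrix.mul_one]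
      rw [hcomm]
      refine isSymm_entries_eq (N := 0) ?_ (by simp) hij fun i j hij => ?_
      · simp [hD, Matrix.mul_assoc, add_comm]
      · have := hent i j
        simpa [hij] using this
  rw [hHe, hK, Matrix.zero_mul]

/-- Converse direction: since invertibility of the derivative is an open condition, this lets
nondegeneracy persist along the curve. -/
lemma nondegenerate_of_gramConjDeriv_injective [LinearOrder α] {D U : Matrix α α ℝ}
    (hU : U * Uᵀ = 1) (h : Function.Injective (gramConjDeriv D U)) :
    Nondegenerate (U * D * Uᵀ) := by
  have hU' : Uᵀ * U = 1 := mul_eq_one_comm.mp hU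
  intro K hK hcomm
  have h0 : gramConjDeriv D U (K * U) = 0 := by
    have e1 : (K * U) * Uᵀ + U * (K * U)ᵀ = 0 := by
      rw [transpose_mul, hK, Matrix.mul_assoc, hU, ← Matrix.mul_assoc, hU]; simp
    have e2 : (K * U) * D * Uᵀ + U * D * (K * U)ᵀ = K * (U * D * Uᵀ) - (U * D * Uᵀ) * K := by
      rw [transpose_mul, hK]; simp [Matrix.mul_assoc, sub_eq_add_neg]
    rw [gramConjDeriv_apply, e1, e2]
    ext i j
    by_cases hij : i ≤ j
    · simp [-not_le, mask_apply, hij]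
    · simpa [-not_le, mask_apply, hij] using hcomm i j (fun h => hij h.le)
  have hKU : K * U = 0 := h (by rw [h0, map_zero])
  calc K = K * U * Uᵀ := by rw [Matrix.mul_assoc, hU, Matrix.mul_one]
    _ = 0 := by rw [hKU, Matrix.zero_mul]

section Norm

attribute [local instance] Matrix.linftyOpNormedRing Matrix.linftyOpNormedAlgebra

lemma gramConj_contDiff [LinearOrder α] (D : Matrix α α ℝ) : ContDiff ℝ 1 (gramConj D) := by
  have ht : ContDiff ℝ 1 (fun U : Matrix α α ℝ => Uᵀ) :=
    (LinearMap.toContinuousLinearMap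
      (Matrix.transposeLinearEquiv α α ℝ ℝ).toLinearMap).contDiff
  have hm (p : α → α → Prop) [∀ i j, Decidable (p i j)] : ContDiff ℝ 1 (mask p) :=
    (LinearMap.toContinuousLinearMap (mask p)).contDiff
  exact ((hm _).comp (contDiff_id.mul ht)).add
    ((hm _).comp ((contDiff_id.mul contDiff_const).mul ht))

lemma gramConj_hasFDerivAt [LinearOrder α] (D U : Matrix α α ℝ) :
    HasFDerivAt (gramConj D) (LinearMap.toContinuousLinearMap (gramConjDeriv D U)) U := by
  have ht : HasFDerivAt (fun U : Matrix α α ℝ => Uᵀ) (LinearMap.toContinuousLinearMap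
      (Matrix.transposeLinearEquiv α α ℝ ℝ).toLinearMap) U :=
    (LinearMap.toContinuousLinearMap
      (Matrix.transposeLinearEquiv α α ℝ ℝ).toLinearMap).hasFDerivAt
  have hm (p : α → α → Prop) [∀ i j, Decidable (p i j)] (V : Matrix α α ℝ) :
      HasFDerivAt (mask p) (LinearMap.toContinuousLinearMap (mask p)) V :=
    (LinearMap.toContinuousLinearMap (mask p)).hasFDerivAt
  have key := ((hm (· ≤ ·) _).comp U ((hasFDerivAt_id U).mul' ht)).add
    ((hm (fun i j => ¬ i ≤ j) _).comp U
      (((hasFDerivAt_id U).mul' (hasFDerivAt_const D U)).mul' ht))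
  refine key.congr_fderiv ?_
  ext1 H
  change mask _ (U * Hᵀ + H * Uᵀ) + mask _ (U * D * Hᵀ + (U * 0 + H * D) * Uᵀ) = _
  rw [Matrix.mul_zero, zero_add, add_comm (U * _), add_comm (U * _ * _)]
  rfl

/-- Inverse function theorem for orthogonal conjugation: the off-diagonal part of a nondegenerate
matrix `A = U D Uᵀ` can be moved in the direction of a commutator `[K, A]` while keeping the
spectrum. -/
theorem exists_orthogonal_curve {D U₀ K : Matrix α α ℝ} (hD : Dᵀ = D)
    (hU₀ : U₀ * U₀ᵀ = 1) (hA : Nondegenerate (U₀ * D * U₀ᵀ)) (hK : Kᵀ = -K) :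
    ∃ U : ℝ → Matrix α α ℝ, U 0 = U₀ ∧
      (∀ i j, HasDerivAt (fun t => U t i j) ((K * U₀) i j) 0) ∧
      ∀ᶠ t in 𝓝 0, U t * (U t)ᵀ = 1 ∧ Nondegenerate (U t * D * (U t)ᵀ) ∧
        ∀ i j, i ≠ j → (U t * D * (U t)ᵀ) i j =
          (U₀ * D * U₀ᵀ + t • (K * (U₀ * D * U₀ᵀ) - (U₀ * D * U₀ᵀ) * K)) i j := by
  classical
  -- An arbitrary order: it splits the index pairs so that orthogonality and the off-diagonal
  -- entries together form a square system.
  let _ : LinearOrder α := linearOrderOfSTO (WellOrderingRel (α := α))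
  have : CompleteSpace (Matrix α α ℝ) := FiniteDimensional.complete ℝ _
  set A := U₀ * D * U₀ᵀ with hAdef
  let f' : Matrix α α ℝ ≃L[ℝ] Matrix α α ℝ := (LinearEquiv.ofInjectiveEndo (gramConjDeriv D U₀)
    (gramConjDeriv_injective hD hU₀ hA)).toContinuousLinearEquiv
  have hf' (H) : f' H = gramConjDeriv D U₀ H := rfl
  have hfd : fderiv ℝ (gramConj D) U₀ = f' := by
    rw [(gramConj_hasFDerivAt D U₀).fderiv]; rfl
  have hf : HasStrictFDerivAt (gramConj D) (f' : Matrix α α ℝ →L[ℝ] Matrix α α ℝ) U₀ := by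
    rw [← hfd]
    exact (gramConj_contDiff D).contDiffAt.hasStrictFDerivAt (by simp)
  have hAs : Aᵀ = A := by simp [hAdef, hD, Matrix.mul_assoc]
  set B := K * A - A * K with hB
  have hBs : Bᵀ = B := by
    simp only [hB, transpose_sub, transpose_mul, hK, hAs]; noncomm_ring
  -- The target path moves only below the diagonal, so the Gram part stays that of the identity and
  -- its preimages are orthogonal.
  let ℓ : ℝ → Matrix α α ℝ := fun t => gramConj D U₀ + t • mask (fun i j => ¬ i ≤ j) B
  have hℓ0 : ℓ 0 = gramConj D U₀ := by simp [ℓ]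
  have hℓ : HasDerivAt ℓ (mask (fun i j => ¬ i ≤ j) B) 0 := by
    have := ((hasDerivAt_id (0 : ℝ)).smul_const (mask (fun i j => ¬ i ≤ j) B)).const_add
      (gramConj D U₀)
    rwa [one_smul] at this
  have hℓt : Tendsto ℓ (𝓝 0) (𝓝 (gramConj D U₀)) := hℓ0 ▸ hℓ.continuousAt
  let U : ℝ → Matrix α α ℝ := fun t => hf.localInverse _ _ _ (ℓ t)
  have hU0 : U 0 = U₀ := by simp only [U, hℓ0]; exact hf.localInverse_apply_image
  have hUd : HasDerivAt U (K * U₀) 0 := by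
    have h1 : HasFDerivAt (hf.localInverse _ _ _) (f'.symm : Matrix α α ℝ →L[ℝ] Matrix α α ℝ)
      (ℓ 0) := by rw [hℓ0]; exact hf.to_localInverse.hasFDerivAt
    have h2 := h1.comp_hasDerivAt 0 hℓ
    suffices h : f'.symm (mask (fun i j => ¬ i ≤ j) B) = K * U₀ from h ▸ h2
    rw [ContinuousLinearEquiv.symm_apply_eq, hf', gramConjDeriv_apply]
    have e1 : (K * U₀) * U₀ᵀ + U₀ * (K * U₀)ᵀ = 0 := by
      rw [transpose_mul, hK, Matrix.mul_assoc, hU₀, ← Matrix.mul_assoc, hU₀]; simp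
    have e2 : (K * U₀) * D * U₀ᵀ + U₀ * D * (K * U₀)ᵀ = B := by
      rw [transpose_mul, hK]; simp [hB, hAdef, Matrix.mul_assoc, sub_eq_add_neg]
    rw [e1, e2]; simp
  refine ⟨U, hU0, fun i j => ?_, ?_⟩
  · have hev : HasFDerivAt (fun M : Matrix α α ℝ => M i j)
        (LinearMap.toContinuousLinearMap (Matrix.entryLinearMap ℝ ℝ i j)) (U 0) :=
      (LinearMap.toContinuousLinearMap (Matrix.entryLinearMap ℝ ℝ i j)).hasFDerivAt
    exact hev.comp_hasDerivAt 0 hUd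
  · have hUc : Tendsto U (𝓝 0) (𝓝 U₀) := hU0 ▸ hUd.continuousAt
    have hr := hℓt.eventually hf.eventually_right_inverse
    have hfc : Tendsto (fderiv ℝ (gramConj D)) (𝓝 U₀) (𝓝 (f' : Matrix α α ℝ →L[ℝ] _)) := by
      rw [← hfd]
      -- Continuity of the derivative keeps it invertible at `U t` for small t.
      exact ((gramConj_contDiff D).continuous_fderiv (by simp)).continuousAt
    have hn := (hfc.comp hUc).eventually (ContinuousLinearEquiv.nhds f')
    filter_upwards [hr, hn] with t ht hnt
    have hent : ∀ i j, gramConj D (U t) i j = ℓ t i j := fun i j => by rw [← ht]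
    have hUt : U t * (U t)ᵀ = 1 := by
      refine eq_of_isSymm_of_upper (by simp) (by simp) fun i j hij => ?_
      have := hent i j
      simpa [-not_le, gramConj, ℓ, mask_apply, hij, hU₀] using this
    refine ⟨hUt, nondegenerate_of_gramConjDeriv_injective hUt ?_, fun i j hij => ?_⟩
    · obtain ⟨g, hg⟩ := hnt
      intro x y hxy
      apply g.injective
      have := hg.trans (gramConj_hasFDerivAt D (U t)).fderiv
      have e (z) : g z = gramConjDeriv D (U t) z := DFunLike.congr_fun this z
      rw [e, e, hxy]
    · refine isSymm_entries_eq ?_ ?_ hij fun i j hij => ?_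
      · simp [hD, Matrix.mul_assoc]
      · simp [hAs, hBs]
      · have := hent i j
        simpa [-not_le, gramConj, ℓ, mask_apply, hij, ← hAdef] using this

end Norm

end Curve

/-! ### Functions of a symmetric matrix through its diagonalisation -/

section ConjDiag

variable {α : Type*} [Fintype α]

lemma hasDerivAt_mulVec {U : ℝ → Matrix α α ℝ} {U' : Matrix α α ℝ} {t : ℝ}
    (h : ∀ i j, HasDerivAt (fun t => U t i j) (U' i j) t) (y : α → ℝ) (i : α) :
    HasDerivAt (fun t => (U t *ᵥ y) i) ((U' *ᵥ y) i) t := by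
  simp only [mulVec, dotProduct]
  exact HasDerivAt.fun_sum fun j _ => (h i j).mul_const _

variable [DecidableEq α]

/-- The matrix `U * diag(e) * Uᵀ`. -/
def conjDiag (U : Matrix α α ℝ) (e : α → ℝ) : Matrix α α ℝ := U * diagonal e * Uᵀ

lemma conjDiag_apply (U : Matrix α α ℝ) (e : α → ℝ) (i j : α) :
    conjDiag U e i j = ∑ k, U i k * e k * U j k := by
  rw [conjDiag, Matrix.mul_apply]
  simp only [mul_diagonal, transpose_apply]

lemma conjDiag_transpose (U : Matrix α α ℝ) (e : α → ℝ) : (conjDiag U e)ᵀ = conjDiag U e := by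
  simp [conjDiag, Matrix.mul_assoc]

lemma conjDiag_mul {U : Matrix α α ℝ} (hU : Uᵀ * U = 1) (e f : α → ℝ) :
    conjDiag U e * conjDiag U f = conjDiag U (e * f) := by
  calc _ = U * diagonal e * (Uᵀ * U) * diagonal f * Uᵀ := by
        simp only [conjDiag, Matrix.mul_assoc]
    _ = _ := by
        rw [hU, Matrix.mul_one, Matrix.mul_assoc U, diagonal_mul_diagonal]; rfl

lemma conjDiag_mulVec_mulVec {U : Matrix α α ℝ} (hU : Uᵀ * U = 1) (e y : α → ℝ) :
    conjDiag U e *ᵥ (U *ᵥ y) = U *ᵥ (e * y) := by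
  rw [mulVec_mulVec, conjDiag, Matrix.mul_assoc, hU, Matrix.mul_one, ← mulVec_mulVec]
  congr 1
  ext i; simp [mulVec_diagonal]

lemma conjDiag_one {U : Matrix α α ℝ} (hU : U * Uᵀ = 1) : conjDiag U 1 = 1 := by
  have : diagonal (1 : α → ℝ) = 1 := diagonal_one
  rw [conjDiag, this, Matrix.mul_one, hU]

lemma conjDiag_const_sub {U : Matrix α α ℝ} (hU : U * Uᵀ = 1) (c : ℝ) (e : α → ℝ) :
    conjDiag U (fun i => c - e i) = c • 1 - conjDiag U e := by
  have : diagonal (fun i => c - e i) = c • (1 : Matrix α α ℝ) - diagonal e := by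
    rw [smul_one_eq_diagonal, diagonal_sub]
  simp [conjDiag, this, mul_sub, sub_mul, hU]

/-- Changing `e` replaces the matrix by a function of it, so this also differentiates resolvents
along the curve. -/
lemma hasDerivAt_conjDiag {U : ℝ → Matrix α α ℝ} {K : Matrix α α ℝ} (hK : Kᵀ = -K) {t : ℝ}
    (h : ∀ i j, HasDerivAt (fun t => U t i j) ((K * U t) i j) t) (e : α → ℝ) (i j : α) :
    HasDerivAt (fun t => conjDiag (U t) e i j)
      ((K * conjDiag (U t) e - conjDiag (U t) e * K) i j) t := by
  have hd : HasDerivAt (fun t => ∑ k, U t i k * e k * U t j k)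
      (∑ k, ((K * U t) i k * e k * U t j k + U t i k * e k * (K * U t) j k)) t :=
    HasDerivAt.fun_sum fun k _ => ((h i k).mul_const _).mul (h j k)
  have e1 : K * conjDiag (U t) e - conjDiag (U t) e * K
      = (K * U t) * diagonal e * (U t)ᵀ + U t * diagonal e * (K * U t)ᵀ := by
    rw [transpose_mul, hK]; simp [conjDiag, Matrix.mul_assoc, sub_eq_add_neg]
  have e2 : (K * conjDiag (U t) e - conjDiag (U t) e * K) i j =
      ∑ k, ((K * U t) i k * e k * U t j k + U t i k * e k * (K * U t) j k) := by
    rw [e1, Finset.sum_add_distrib, Matrix.add_apply, Matrix.mul_apply, Matrix.mul_apply]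
    simp only [mul_diagonal, transpose_apply]
  simp only [conjDiag_apply] at e2 ⊢
  rw [e2]
  exact hd

end ConjDiag

/-! ### Generic vectors and the induction hypothesis -/

/-- There is a vector with prescribed nonempty support which is not orthogonal to any of finitely
many nowhere-zero vectors. -/
lemma exists_support_dotProduct_ne_zero {ι : Type*} [Fintype ι] (N : ι → Prop) (hN : ∃ i, N i)
    {T : Set (ι → ℝ)} (hT : T.Finite) (h0 : ∀ g ∈ T, NowhereZero g) :
    ∃ b : ι → ℝ, (∀ i, b i ≠ 0 ↔ N i) ∧ ∀ g ∈ T, g ⬝ᵥ b ≠ 0 := by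
  classical
  have := hT.to_subtype
  let v : T ⊕ {i // N i} → ι → ℝ :=
    Sum.elim (fun g i => if N i then g.1 i else 0) (fun i => Pi.single i.1 1)
  have hv : ∀ x, v x ≠ 0 := by
    rintro (g | i) h
    · obtain ⟨i, hi⟩ := hN
      exact h0 g.1 g.2 i (by simpa [v, hi] using congrFun h i)
    · simpa [v] using congrFun h i.1
  -- One functional avoiding finitely many hyperplanes; its coordinates on the support form `b`.
  obtain ⟨f, hf⟩ := Module.exists_dual_forall_apply_ne_zero (K := ℝ) v hv
  refine ⟨fun i => if N i then f (Pi.single i 1) else 0, fun i => ?_, fun g hg => ?_⟩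
  · by_cases hi : N i
    · simpa [hi] using show f (Pi.single i 1) ≠ 0 from hf (.inr ⟨i, hi⟩)
    · simp [hi]
  · have := hf (.inl ⟨g, hg⟩)
    rw [LinearMap.pi_apply_eq_sum_univ f] at this
    convert this using 1
    refine Finset.sum_congr rfl fun i _ => ?_
    have hs : (Pi.single i 1 : ι → ℝ) = fun j => if i = j then 1 else 0 := by
      ext j; simp [Pi.single_apply, eq_comm]
    by_cases hi : N i <;> simp [v, hi, hs]

/-- A strong form of generic realisability, stable under adding a vertex: the matrix can moreover
be chosen nondegenerate, and with finitely many resolvents having no zero entry. -/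
def RobustlyRealisable {α : Type*} [Fintype α] [DecidableEq α] (G : SimpleGraph α) : Prop :=
  ∀ d : α → ℝ, Function.Injective d →
    ∀ Y : Set (α → ℝ), Y.Finite → (∀ y ∈ Y, y ≠ 0) →
      ∀ C : Set ℝ, C.Finite → (∀ c ∈ C, ∀ i, c - d i ≠ 0) →
        ∃ U : Matrix α α ℝ, U * Uᵀ = 1 ∧ conjDiag U d ∈ S G ∧ Nondegenerate (conjDiag U d) ∧
          (∀ y ∈ Y, NowhereZero (U *ᵥ y)) ∧
          ∀ c ∈ C, ∀ i j, conjDiag U (fun k => (c - d k)⁻¹) i j ≠ 0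

lemma RobustlyRealisable.of_subsingleton {α : Type*} [Fintype α] [DecidableEq α]
    [Subsingleton α] (G : SimpleGraph α) : RobustlyRealisable G := by
  intro d _ Y _ hY C _ hC
  refine ⟨1, by simp, ⟨conjDiag_transpose _ _, fun i j h => (h (Subsingleton.elim i j)).elim⟩,
    fun K hK _ => ?_, fun y hy i => ?_, fun c hc i j => ?_⟩
  · ext i j
    obtain rfl := Subsingleton.elim i j
    have : K i i = -K i i := congrFun (congrFun hK i) i
    change K i i = 0
    linarith
  · rw [one_mulVec]
    intro h
    exact hY y hy (funext fun j => by rw [Subsingleton.elim j i, h]; rfl)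
  · obtain rfl := Subsingleton.elim i j
    simpa [conjDiag] using hC c hc i

/-! ### Adding a vertex -/

section Step

variable {W : Type*}

/-- The skew-symmetric matrix with zero diagonal blocks and last column `k`. -/
def skewBorder (k : W → ℝ) : Matrix (W ⊕ Unit) (W ⊕ Unit) ℝ :=
  fromBlocks 0 (replicateCol Unit k) (-replicateRow Unit k) 0

lemma skewBorder_transpose (k : W → ℝ) : (skewBorder k)ᵀ = -skewBorder k := by
  ext (i | i) (j | j) <;> simp [skewBorder]

/-- `U` extended by a fixed basis vector. -/
def extendOne (U : Matrix W W ℝ) : Matrix (W ⊕ Unit) (W ⊕ Unit) ℝ := fromBlocks U 0 0 1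

variable [Fintype W]

lemma extendOne_mulVec (U : Matrix W W ℝ) (y : W ⊕ Unit → ℝ) :
    extendOne U *ᵥ y = Sum.elim (U *ᵥ (y ∘ Sum.inl)) (y ∘ Sum.inr) := by
  simp [extendOne, fromBlocks_mulVec]

lemma skewBorder_mulVec_inl (k : W → ℝ) (x : W ⊕ Unit → ℝ) (i : W) :
    (skewBorder k *ᵥ x) (.inl i) = k i * x (.inr ()) := by
  simp [skewBorder, mulVec, dotProduct]

lemma skewBorder_mulVec_inr (k : W → ℝ) (x : W ⊕ Unit → ℝ) :
    (skewBorder k *ᵥ x) (.inr ()) = -(k ⬝ᵥ (x ∘ Sum.inl)) := by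
  simp [skewBorder, mulVec, dotProduct]

variable [DecidableEq W]

lemma extendOne_mul_transpose {U : Matrix W W ℝ} (hU : U * Uᵀ = 1) :
    extendOne U * (extendOne U)ᵀ = 1 := by
  simp [extendOne, fromBlocks_transpose, fromBlocks_multiply, hU]

lemma conjDiag_extendOne (U : Matrix W W ℝ) (e : W ⊕ Unit → ℝ) :
    conjDiag (extendOne U) e =
      fromBlocks (conjDiag U (e ∘ Sum.inl)) 0 0 (diagonal (e ∘ Sum.inr)) := by
  have : diagonal e = fromBlocks (diagonal (e ∘ Sum.inl)) 0 0 (diagonal (e ∘ Sum.inr)) := by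
    rw [fromBlocks_diagonal]; congr 1; ext (i | i) <;> rfl
  rw [conjDiag, this]
  simp [-fromBlocks_diagonal, conjDiag, extendOne, fromBlocks_transpose, fromBlocks_multiply]

lemma skewBorder_comm_inl_inl (k : W → ℝ) (U : Matrix W W ℝ) (e : W ⊕ Unit → ℝ) (i j : W) :
    (skewBorder k * conjDiag (extendOne U) e - conjDiag (extendOne U) e * skewBorder k)
      (.inl i) (.inl j) = 0 := by
  simp [skewBorder, conjDiag_extendOne, fromBlocks_multiply]

lemma skewBorder_comm_inl_inr (k : W → ℝ) (U : Matrix W W ℝ) (e : W ⊕ Unit → ℝ) (i : W) :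
    (skewBorder k * conjDiag (extendOne U) e - conjDiag (extendOne U) e * skewBorder k)
      (.inl i) (.inr ()) = e (.inr ()) * k i - (conjDiag U (e ∘ Sum.inl) *ᵥ k) i := by
  simp [skewBorder, conjDiag_extendOne, fromBlocks_multiply, Matrix.mul_apply, mulVec, dotProduct,
    mul_comm]

lemma skewBorder_comm_inr_inl (k : W → ℝ) (U : Matrix W W ℝ) (e : W ⊕ Unit → ℝ) (i : W) :
    (skewBorder k * conjDiag (extendOne U) e - conjDiag (extendOne U) e * skewBorder k)
      (.inr ()) (.inl i) = e (.inr ()) * k i - (conjDiag U (e ∘ Sum.inl) *ᵥ k) i := by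
  rw [← skewBorder_comm_inl_inr]
  set A := conjDiag (extendOne U) e with hA
  have : (skewBorder k * A - A * skewBorder k)ᵀ = skewBorder k * A - A * skewBorder k := by
    simp only [transpose_sub, transpose_mul, skewBorder_transpose, hA, conjDiag_transpose]
    noncomm_ring
  exact congrFun (congrFun this (.inl i)) (.inr ())

/-- The large block of K dies by hypothesis. Its border k satisfies (δ - A₁)k = 0, where δ is not an
eigenvalue of A₁, so k = 0. -/
lemma Nondegenerate.extendOne {U : Matrix W W ℝ} (hU : U * Uᵀ = 1) {d : W ⊕ Unit → ℝ}
    (hd : ∀ i : W, d (.inr ()) - d (.inl i) ≠ 0) (h : Nondegenerate (conjDiag U (d ∘ Sum.inl))) :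
    Nondegenerate (conjDiag (extendOne U) d) := by
  have hU' : Uᵀ * U = 1 := mul_eq_one_comm.mp hU
  intro K hK hcomm
  have hKs : ∀ i j, K j i = - K i j := fun i j => congrFun (congrFun hK i) j
  set k : W → ℝ := fun i => K (.inl i) (.inr ()) with hk
  have h11 : K.toBlocks₁₁ = 0 := by
    apply h
    · ext i j; exact hKs _ _
    · intro i j hij
      have := hcomm (.inl i) (.inl j) (by simpa using hij)
      rw [conjDiag_extendOne] at this
      simpa [Matrix.mul_apply, toBlocks₁₁, Fintype.sum_sum_type] using this
  have hk0 : k = 0 := by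
    have h1 : conjDiag U (fun i => d (.inr ()) - d (.inl i)) *ᵥ k = 0 := by
      rw [conjDiag_const_sub hU]
      ext i
      have := hcomm (.inl i) (.inr ()) (by simp)
      rw [conjDiag_extendOne] at this
      rw [sub_mulVec, smul_mulVec, one_mulVec]
      simpa [Matrix.mul_apply, Fintype.sum_sum_type, mulVec, dotProduct, hk, mul_comm,
        Function.comp_def] using this
    have h2 : conjDiag U (fun i => (d (.inr ()) - d (.inl i))⁻¹) *
        conjDiag U (fun i => d (.inr ()) - d (.inl i)) = 1 := by
      rw [conjDiag_mul hU', ← conjDiag_one hU]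
      congr 1
      ext i
      simp [hd i]
    calc k = (1 : Matrix W W ℝ) *ᵥ k := (one_mulVec k).symm
      _ = 0 := by rw [← h2, ← mulVec_mulVec, h1, mulVec_zero]
  ext (i | i) (j | j)
  · exact congrFun (congrFun h11 i) j
  · exact congrFun hk0 i
  · rw [hKs]; simpa using congrFun hk0 j
  · have := hKs (.inr i) (.inr j)
    obtain rfl : i = j := rfl
    change K (.inr i) (.inr i) = 0
    linarith

/-- Robust realisability is inherited when a vertex with at least one neighbour is added. -/
theorem RobustlyRealisable.add_vertex (G : SimpleGraph (W ⊕ Unit))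
    (hG : RobustlyRealisable (G.comap Sum.inl)) (hadj : ∃ w, G.Adj (.inl w) (.inr ())) :
    RobustlyRealisable G := by
  intro d hd Y hYf hY C hCf hC
  set δ := d (.inr ()) with hδ
  set f : W → ℝ := fun i => (δ - d (.inl i))⁻¹ with hf
  have hδd : ∀ i : W, δ - d (.inl i) ≠ 0 := fun i h => by
    have := hd (sub_eq_zero.mp h)
    simp at this
  have hf0 : ∀ i, f i ≠ 0 := fun i => inv_ne_zero (hδd i)
  -- The vectors `f * (y ∘ Sum.inl)` will control the derivative of the last coordinate of `U t *ᵥ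
  -- y`. Adding δ to `C` lets k be nowhere zero.
  obtain ⟨U₁, hU₁, hS₁, hN₁, hY₁, hC₁⟩ := hG (d ∘ Sum.inl) (hd.comp Sum.inl_injective)
    {z | z ∈ (fun y : W ⊕ Unit → ℝ => y ∘ Sum.inl) '' Y ∪
        (fun y : W ⊕ Unit → ℝ => f * (y ∘ Sum.inl)) '' Y ∧ z ≠ 0}
    (((hYf.image _).union (hYf.image _)).subset fun z hz => hz.1) (fun z hz => hz.2)
    (insert δ C) (hCf.insert δ)
    (by
      rintro c (rfl | hc) i
      · exact hδd i
      · exact hC c hc _)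
  have hU₁' : U₁ᵀ * U₁ = 1 := mul_eq_one_comm.mp hU₁
  obtain ⟨b, hb, hbT⟩ := exists_support_dotProduct_ne_zero
    (fun w => G.Adj (.inl w) (.inr ())) hadj
    (T := (⋃ c ∈ insert δ C, Set.range (conjDiag U₁ (fun k => (c - d (.inl k))⁻¹))) ∪
      (fun y : W ⊕ Unit → ℝ => U₁ *ᵥ (f * (y ∘ Sum.inl))) '' {y ∈ Y | y ∘ Sum.inl ≠ 0})
    (((hCf.insert δ).biUnion fun c _ => Set.finite_range _).union
      ((hYf.subset (Set.sep_subset _ _)).image _))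
    (by
      rintro g (hg | ⟨y, ⟨hy, hy0⟩, rfl⟩)
      · simp only [Set.mem_iUnion] at hg
        obtain ⟨c, hc, i, rfl⟩ := hg
        exact fun j => hC₁ c hc i j
      · refine hY₁ _ ⟨.inr ⟨y, hy, rfl⟩, fun h => hy0 (funext fun i => ?_)⟩
        have := congrFun h i
        simpa [hf0 i] using this)
  have hbC : ∀ c ∈ insert δ C, ∀ i, (conjDiag U₁ (fun k => (c - d (.inl k))⁻¹) *ᵥ b) i ≠ 0 :=
    fun c hc i => hbT _ (.inl (by simp only [Set.mem_iUnion]; exact ⟨c, hc, i, rfl⟩))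
  -- `f` gives the resolvent at δ, so k solves (δ - A₁)k = b.
  set k : W → ℝ := conjDiag U₁ f *ᵥ b with hk
  have hk0 : ∀ i, k i ≠ 0 := hbC δ (Set.mem_insert _ _)
  have hkmul (ρ : ℝ) (e : W → ℝ) (i : W) : ρ * k i - (conjDiag U₁ e *ᵥ k) i =
      (conjDiag U₁ (fun i => (ρ - e i) * f i) *ᵥ b) i := by
    have : conjDiag U₁ (fun i => (ρ - e i) * f i) = (ρ • 1 - conjDiag U₁ e) * conjDiag U₁ f := by
      rw [← conjDiag_const_sub hU₁, conjDiag_mul hU₁']; rfl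
    rw [this, ← mulVec_mulVec, ← hk, sub_mulVec, smul_mulVec, one_mulVec]
    simp
  have hkA (i : W) : δ * k i - (conjDiag U₁ (d ∘ Sum.inl) *ᵥ k) i = b i := by
    rw [hkmul]
    have : (fun i => (δ - (d ∘ Sum.inl) i) * f i) = 1 := by
      ext i; simp [hf, hδd i]
    rw [this, conjDiag_one hU₁, one_mulVec]
  have hkR (c : ℝ) (hc : c ∈ C) (i : W) : (c - δ)⁻¹ * k i -
      (conjDiag U₁ (fun j => (c - d (.inl j))⁻¹) *ᵥ k) i ≠ 0 := by
    rw [hkmul]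
    -- The resolvent identity, read on eigenvalues.
    have : conjDiag U₁ (fun i => ((c - δ)⁻¹ - (c - d (.inl i))⁻¹) * f i) =
        (c - δ)⁻¹ • conjDiag U₁ (fun i => (c - d (.inl i))⁻¹) := by
      ext i j
      simp only [conjDiag_apply, Matrix.smul_apply, smul_eq_mul, Finset.mul_sum]
      refine Finset.sum_congr rfl fun l _ => ?_
      have h1 := hC c hc (.inr ())
      have h2 := hC c hc (.inl l)
      have h3 := hδd l
      have : ((c - δ)⁻¹ - (c - d (.inl l))⁻¹) * f l = (c - δ)⁻¹ * (c - d (.inl l))⁻¹ := by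
        rw [← hδ] at h1
        simp only [hf]
        field_simp
        ring
      rw [this]; ring
    rw [this, smul_mulVec]
    exact mul_ne_zero (inv_ne_zero (hC c hc (.inr ()))) (hbC c (Set.mem_insert_of_mem _ hc) i)
  obtain ⟨U, hU0, hUd, hUe⟩ := exists_orthogonal_curve (D := diagonal d) (by simp)
    (extendOne_mul_transpose hU₁) (Nondegenerate.extendOne hU₁ hδd hN₁) (skewBorder_transpose k)
  rw [← hU0] at hUd
  -- The point t = 0 is excluded because some entries vanish there and only become nonzero to first
  -- order.
  have key {g : ℝ → ℝ} {g' : ℝ} (hg : HasDerivAt g g' 0) (h : g 0 ≠ 0 ∨ g' ≠ 0) :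
      ∀ᶠ t in 𝓝[≠] 0, g t ≠ 0 := by
    rcases h with h | h
    · exact (hg.continuousAt.eventually_ne h).filter_mono nhdsWithin_le_nhds
    · exact hg.eventually_ne h
  have hYev : ∀ᶠ t in 𝓝[≠] (0 : ℝ), ∀ y ∈ Y, ∀ i, (U t *ᵥ y) i ≠ 0 := by
    rw [eventually_all_finite hYf]
    intro y hy
    rw [eventually_all]
    intro i
    refine key (hasDerivAt_mulVec hUd y i) ?_
    rw [hU0, ← mulVec_mulVec, extendOne_mulVec]
    by_cases hy' : y ∘ Sum.inl = 0
    · have hη : y (.inr ()) ≠ 0 := fun h => hY y hy (by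
        ext (i | i)
        · exact congrFun hy' i
        · exact h)
      rcases i with i | i
      · right
        rw [skewBorder_mulVec_inl]
        exact mul_ne_zero (hk0 i) hη
      · exact .inl hη
    · rcases i with i | i
      · exact .inl (hY₁ _ ⟨.inl ⟨y, hy, rfl⟩, hy'⟩ i)
      · right
        rw [show i = () from rfl, skewBorder_mulVec_inr, neg_ne_zero]
        have := hbT _ (.inr ⟨y, ⟨hy, hy'⟩, rfl⟩)
        simp only at this
        rw [← conjDiag_mulVec_mulVec hU₁'] at this
        -- Symmetry of the resolvent moves it from `b` onto `U₁ *ᵥ (y ∘ Sum.inl)`, giving a vector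
        -- that `b` was chosen not to be orthogonal to.
        rw [dotProduct_comm, hk, dotProduct_mulVec, ← mulVec_transpose, conjDiag_transpose]
        exact this
  have hCev : ∀ᶠ t in 𝓝[≠] (0 : ℝ), ∀ c ∈ C, ∀ i j,
      conjDiag (U t) (fun l => (c - d l)⁻¹) i j ≠ 0 := by
    rw [eventually_all_finite hCf]
    intro c hc
    rw [eventually_all]
    intro i
    rw [eventually_all]
    intro j
    refine key (hasDerivAt_conjDiag (skewBorder_transpose k) hUd _ i j) ?_
    rw [hU0]
    rcases i with i | i <;> rcases j with j | j
    · left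
      rw [conjDiag_extendOne]
      exact hC₁ c (Set.mem_insert_of_mem _ hc) i j
    · right
      rw [skewBorder_comm_inl_inr]
      exact hkR c hc i
    · right
      rw [skewBorder_comm_inr_inl]
      exact hkR c hc j
    · left
      rw [conjDiag_extendOne]
      simpa using hC c hc (.inr ())
  obtain ⟨t, ⟨⟨hYt, hCt⟩, hUt⟩, ht0⟩ := (((hYev.and hCev).and
    (hUe.filter_mono nhdsWithin_le_nhds)).and self_mem_nhdsWithin).exists
  have ht0 : t ≠ 0 := ht0
  obtain ⟨hUt, hNt, hAt⟩ := hUt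
  refine ⟨U t, hUt, ⟨conjDiag_transpose _ _, fun i j hij => ?_⟩, hNt, hYt, hCt⟩
  change (U t * diagonal d * (U t)ᵀ) i j ≠ 0 ↔ _
  rw [hAt i j hij]
  change (conjDiag (extendOne U₁) d + t • (skewBorder k * conjDiag (extendOne U₁) d -
    conjDiag (extendOne U₁) d * skewBorder k)) i j ≠ 0 ↔ _
  rw [Matrix.add_apply, Matrix.smul_apply]
  rcases i with i | i <;> rcases j with j | j
  · rw [skewBorder_comm_inl_inl, conjDiag_extendOne]
    simpa using hS₁.2 i j (by simpa using hij)
  · rw [skewBorder_comm_inl_inr, conjDiag_extendOne, ← hδ, hkA]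
    simpa [ht0] using hb i
  · rw [skewBorder_comm_inr_inl, conjDiag_extendOne, ← hδ, hkA, G.adj_comm]
    simpa [ht0] using hb j
  · exact (hij rfl).elim

end Step

/-! ### Induction over connected graphs -/

/-- Robust realisability is invariant under relabelling the vertices. -/
lemma RobustlyRealisable.of_equiv {α β : Type*} [Fintype α] [DecidableEq α] [Fintype β]
    [DecidableEq β] (e : β ≃ α) {G : SimpleGraph α} (h : RobustlyRealisable (G.comap e)) :
    RobustlyRealisable G := by
  intro d hd Y hYf hY C hCf hC
  obtain ⟨U, hU, hS, hN, hUY, hUC⟩ := h (d ∘ e) (hd.comp e.injective)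
    ((fun y : α → ℝ => y ∘ e) '' Y) (hYf.image _)
    (by
      rintro _ ⟨y, hy, rfl⟩ h0
      refine hY y hy (funext fun i => ?_)
      simpa using congrFun h0 (e.symm i))
    C hCf (fun c hc i => hC c hc _)
  have hconj (f : α → ℝ) : conjDiag (U.submatrix e.symm e.symm) f =
      (conjDiag U (f ∘ e)).submatrix e.symm e.symm := by
    ext i j
    simp only [conjDiag_apply, submatrix_apply]
    exact (Fintype.sum_equiv e _ _ fun k => by simp).symm
  refine ⟨U.submatrix e.symm e.symm, ?_, ⟨conjDiag_transpose _ _, fun i j hij => ?_⟩, ?_,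
    fun y hy i => ?_, fun c hc i j => ?_⟩
  · rw [transpose_submatrix, submatrix_mul_equiv, hU, submatrix_one_equiv]
  · rw [hconj]
    simpa using hS.2 (e.symm i) (e.symm j) (by simpa using hij)
  · rw [hconj]
    intro K hK hcomm
    have h0 : K.submatrix e e = 0 := by
      apply hN
      · rw [transpose_submatrix, hK]; rfl
      · intro i j hij
        have h1 := hcomm (e i) (e j) (by simpa using hij)
        have h2 : K = (K.submatrix e e).submatrix e.symm e.symm := by simp
        rw [h2, submatrix_mul_equiv, submatrix_mul_equiv] at h1
        simpa using h1
    ext i j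
    simpa using congrFun (congrFun h0 (e.symm i)) (e.symm j)
  · have h1 : U.submatrix e.symm e.symm *ᵥ y = (U *ᵥ (y ∘ e)) ∘ e.symm := by
      rw [submatrix_mulVec_equiv]; rfl
    rw [h1]
    exact hUY _ ⟨y, hy, rfl⟩ (e.symm i)
  · rw [hconj]
    exact hUC c hc (e.symm i) (e.symm j)

/-- Every connected graph is robustly realisable. -/
theorem robustlyRealisable_of_connected {α : Type*} [Fintype α] [DecidableEq α]
    {G : SimpleGraph α} (hG : G.Connected) : RobustlyRealisable G := by
  induction h : Fintype.card α generalizing α with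
  | zero =>
    have := Fintype.card_eq_zero_iff.mp h
    exact (this.false hG.nonempty.some).elim
  | succ n ih =>
    rcases subsingleton_or_nontrivial α with _ | _
    · exact .of_subsingleton G
    · obtain ⟨v, hv⟩ := hG.exists_connected_induce_compl_singleton_of_finite_nontrivial
      let e : ({v}ᶜ : Set α) ⊕ Unit ≃ α :=
        (Equiv.sumComm _ _).trans
          (((Equiv.ofUnique Unit ({v} : Set α)).sumCongr (Equiv.refl _)).trans
            (Equiv.Set.sumCompl {v}))
      have hel (w) : e (.inl w) = w.1 := by simp [e]
      have her (u) : e (.inr u) = v := by simp [e]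
      refine .of_equiv e (.add_vertex _ ?_ ?_)
      · have : (G.comap e).comap Sum.inl = G.induce {v}ᶜ := by
          ext a b; simp [hel]
        rw [this]
        refine ih hv ?_
        rw [Fintype.card_compl_set, h]; simp
      · obtain ⟨w, hw⟩ := hG.preconnected.exists_adj_of_nontrivial v
        exact ⟨⟨w, hw.ne'⟩, by simpa [hel, her] using hw.symm⟩

/-! ### Spectra as multisets and zero-one multiplicities -/

lemma spec_conjDiag {α : Type*} [Fintype α] [DecidableEq α] {U : Matrix α α ℝ}
    (hU : U * Uᵀ = 1) (d : α → ℝ) : spec (conjDiag U d) = Finset.univ.val.map d := by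
  rw [spec, conjDiag, Matrix.mul_assoc, charpoly_mul_comm, Matrix.mul_assoc,
    mul_eq_one_comm.mp hU, Matrix.mul_one, charpoly_diagonal]
  have : ∏ i, (Polynomial.X - Polynomial.C (d i)) =
      ((Finset.univ.val.map d).map fun a => Polynomial.X - Polynomial.C a).prod := by
    rw [Multiset.map_map]; rfl
  rw [this, Polynomial.roots_multiset_prod_X_sub_C]

lemma exists_map_univ_eq {α β : Type*} [Fintype α] (s : Multiset β)
    (hs : s.card = Fintype.card α) : ∃ d : α → β, Finset.univ.val.map d = s := by
  obtain ⟨l, rfl⟩ := Quot.exists_rep s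
  let e : α ≃ Fin l.length := Fintype.equivFinOfCardEq hs.symm
  refine ⟨l.get ∘ e, ?_⟩
  rw [← Multiset.map_map, Multiset.map_univ_val_equiv]
  change (List.map l.get (List.finRange _) : Multiset β) = _
  simp

/-- A set of distinct reals, one for each vertex, is generically realisable for every connected
graph. -/
theorem genericallyRealisable_of_nodup {α : Type*} [Fintype α] [DecidableEq α]
    {G : SimpleGraph α} (hG : G.Connected) {σ : Multiset ℝ} (hσ : σ.Nodup)
    (hcard : σ.card = Fintype.card α) : GenericallyRealisable G σ := by
  have hR := robustlyRealisable_of_connected hG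
  have hinj {d : α → ℝ} (hd : Finset.univ.val.map d = σ) : Function.Injective d := fun i j hij =>
    Multiset.inj_on_of_nodup_map (hd ▸ hσ) i (Finset.mem_univ i) j (Finset.mem_univ j) hij
  refine ⟨?_, fun d hd Y hYf hY => ?_⟩
  · obtain ⟨d, hd⟩ := exists_map_univ_eq (α := α) σ hcard
    obtain ⟨U, hU, hS, -⟩ := hR d (hinj hd) ∅ Set.finite_empty (by simp) ∅ Set.finite_empty
      (by simp)
    exact ⟨_, hS, (spec_conjDiag hU d).trans hd⟩
  · obtain ⟨U, hU, hS, -, hUY, -⟩ := hR d (hinj hd) Y hYf hY ∅ Set.finite_empty (by simp)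
    exact ⟨U, (mem_orthogonalGroup_iff α ℝ).mpr hU, hS, hUY⟩

lemma card_withMult {r : ℕ} (m : Fin r → ℕ) (l : Fin r → ℝ) :
    (withMult m l).card = ∑ j, m j := by
  simp [withMult]

lemma nodup_withMult {r : ℕ} {m : Fin r → ℕ} (hm : ∀ j, m j = 0 ∨ m j = 1) {l : Fin r → ℝ}
    (hl : Function.Injective l) : (withMult m l).Nodup := by
  rw [Multiset.nodup_iff_count_le_one]
  intro a
  rw [withMult, Multiset.count_sum']
  simp only [Multiset.count_replicate]
  by_cases h : ∃ j, l j = a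
  · obtain ⟨j, rfl⟩ := h
    rw [Finset.sum_eq_single j (fun i _ hij => if_neg (hl.ne hij)) (by simp)]
    rcases hm j with h | h <;> simp [h]
  · push Not at h
    simp [h]

end IEPG

theorem mainTheorem1 {α : Type*} [Fintype α] (G : SimpleGraph α) {r k : ℕ}
    (e : Fin k ≃ G.ConnectedComponent) (V : Matrix (Fin r) (Fin k) ℕ)
    (hV : IEPG.IsZeroOne V) (hfit : IEPG.Fits G e V) :
    IEPG.GenericallyRealisableMatrix G e V := by
  classical
  have key (i : Fin k) (l : Fin r → ℝ) (hl : StrictMono l) :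
      IEPG.GenericallyRealisable (e i).toSimpleGraph (IEPG.withMult (fun j => V j i) l) :=
    IEPG.genericallyRealisable_of_nodup (e i).connected_toSimpleGraph
      (IEPG.nodup_withMult (fun j => hV j i) hl.injective)
      (by rw [IEPG.card_withMult, hfit i, Nat.card_eq_fintype_card])
  -- Being a multiplicity matrix needs only one increasing choice of eigenvalues; 0, 1, …, r - 1
  -- serves.
  have hmono : StrictMono fun j : Fin r => ((j : ℕ) : ℝ) :=
    fun a b hab => Nat.cast_lt.mpr hab
  constructor
  · intro i
    refine ⟨_, hmono, ?_⟩
    convert (key i _ hmono).1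
  · intro i
    refine ⟨fun l hl => ?_, fun l hl => ?_⟩
    · convert (key i l hl).1
    · convert key i l hl
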